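/- Let $H$ be a finite-dimensional complex Hilbert space. For positive operators $X,Y$ on $H$ with $X$ invertible and $\alpha\in[0,1]$ let $X\sharp_\alpha Y = X^{1/2}(X^{-1/2}YX^{-1/2})^{\alpha}X^{1/2}$. For $w>0$, $w\neq 1$ and $0<\alpha<1$ let $$K(w,\alpha)=\frac{w^\alpha-w}{(\alpha-1)(w-1)}\left(\frac{\alpha-1}{\alpha}\cdot\frac{w^\alpha-1}{w^\alpha-w}\right)^{\alpha},\qquad K(1,\alpha)=1,$$ be the generalized Kantorovich constant. Theorem. Let $f:[0,\infty)\to[0,\infty)$ be continuous, increasing (that is, non-decreasing), and doubly concave, i.e. concave and geometrically concave: $f(x^{\alpha}y^{1-\alpha})\ge f(x)^{\alpha}f(y)^{1-\alpha}$ for all $x,y\ge 0$ and $\alpha\in[0,1]$. Let $p,q>1$ with $\frac1p+\frac1q=1$, and let $A,B$ be positive operators on $H$ with $0<sA^p\le B^q\le tA^p$ for some scalars $0<s\le t$; put $w=t/s$. (If $f\equiv 0$, read $0\,\sharp_{1/q}\,0=0$; otherwise $f(A^p)$ is invertible.) Then there is a unitary operator $U$ on $H$ such that $$f\left(A^p\sharp_{1/q}B^q\right)\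 \ge\ K(w,1/q)\;U\left(f(A^p)\sharp_{1/q}f(B^q)\right)U^*,$$ and, with the same $U$, if in addition $s\le 1\le t$ and $f$ is operator monotone on $H$ (that is, $f(S)\ge f(T)$ whenever $S\ge T$ are strictly positive operators on $H$), then for all $x\in H$ $$\left\langle f\left(A^p\sharp_{1/q}B^q\right)Ux,Ux\right\rangle\ \ge\ K(w,1/q)^2\,\langle f(A^p)x,x\rangle^{1/p}\,\langle f(B^q)x,x\rangle^{1/q}.$$ -/

import Mathlib

open Set

noncomputable section

/-- A non-negative continuous function on `J ⊆ [0, ∞)` is doubly concave if it is concave and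
geometrically concave on `J`. -/
structure DoublyConcaveOn (J : Set ℝ) (f : ℝ → ℝ) : Prop where
  nonneg : ∀ x ∈ J, 0 ≤ f x
  continuousOn : ContinuousOn f J
  concave : ConcaveOn ℝ J f
  geomConcave : ∀ x ∈ J, ∀ y ∈ J, ∀ α ∈ Icc (0 : ℝ) 1,
    f x ^ α * f y ^ (1 - α) ≤ f (x ^ α * y ^ (1 - α))

/-- The generalized Kantorovich constant `K(w, α)` for `w > 0` and `0 < α < 1`. At `w = 1`, where
the displayed formula reads `0 / 0`, it is given its limit value `1`. -/
def genKantorovich (w α : ℝ) : ℝ :=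
  if w = 1 then 1
  else (w ^ α - w) / ((α - 1) * (w - 1)) *
    ((α - 1) / α * ((w ^ α - 1) / (w ^ α - w))) ^ α

section Operators

variable {H : Type*} [NormedAddCommGroup H] [InnerProductSpace ℂ H] [CompleteSpace H]

/-- The weighted geometric mean `A ♯_α B = A^{1/2} (A^{-1/2} B A^{-1/2})^α A^{1/2}`. -/
def opGeomMean (α : ℝ) (A B : H →L[ℂ] H) : H →L[ℂ] H :=
  A ^ (1 / 2 : ℝ) * (A ^ (-(1 / 2) : ℝ) * B * A ^ (-(1 / 2) : ℝ)) ^ α * A ^ (1 / 2 : ℝ)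

variable (H) in
/-- `f` is operator monotone on `(0, ∞)`, for operators on the given space `H`: `B ≤ A` implies
`f(B) ≤ f(A)` for strictly positive `A`, `B`. (This is implied by monotonicity on every Hilbert
space.) -/
def OperatorMonotone (f : ℝ → ℝ) : Prop :=
  ∀ A B : H →L[ℂ] H, IsStrictlyPositive A → IsStrictlyPositive B → B ≤ A → cfc f B ≤ cfc f A

end Operators

end

/-!
For a concave `f`, Jensen's inequality `⟪f(T) x, x⟫ ≤ f ⟪T x, x⟫` at unit vectors `x`, applied to a
power function, gives `⟪(C ♯_α D) x, x⟫ ≤ ⟪D x, x⟫ ^ α * ⟪C x, x⟫ ^ (1 - α)`. When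
`s C ≤ D ≤ t C`, bounding `r ↦ r ^ α` from below by its chord over `[s, t]` reverses this inequality
up to a factor, and optimising by weighted AM-GM shows that the factor is exactly `K(t / s, α)`.
Together with double concavity of `f` this yields
`K(t / s, α) * ⟪(f(C) ♯_α f(D)) x, x⟫ ≤ f ⟪(C ♯_α D) x, x⟫` for every unit vector `x`.

By the min-max principle and monotonicity of `f`, each ordered eigenvalue of the operator on the
left is at most `f` of the corresponding eigenvalue of `C ♯_α D`, and the unitary `U` carries the
one eigenbasis to the other. For the second inequality, when `s ≤ 1 ≤ t`, operator monotonicity and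
concavity give `s f(C) ≤ f(s C) ≤ f(D) ≤ f(t C) ≤ t f(C)`, so the reversed inequality applies once
more, to `f(C)` and `f(D)`, with the same constant.
-/

theorem mul_le_map_mul_of_concaveOn {f : ℝ → ℝ} (hf : ConcaveOn ℝ (Ici 0) f) (hf0 : 0 ≤ f 0)
    {k x : ℝ} (hk0 : 0 ≤ k) (hk1 : k ≤ 1) (hx : 0 ≤ x) : k * f x ≤ f (k * x) := by
  have h := hf.2 (mem_Ici.2 hx) self_mem_Ici hk0 (sub_nonneg.2 hk1) (add_sub_cancel k 1)
  simp only [smul_eq_mul, mul_zero, add_zero] at h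
  exact (le_add_of_nonneg_right (mul_nonneg (sub_nonneg.2 hk1) hf0)).trans h

theorem eqOn_zero_or_forall_pos_of_concaveOn {f : ℝ → ℝ} (hf : ConcaveOn ℝ (Ici 0) f)
    (hf0 : ∀ x ∈ Ici 0, 0 ≤ f x) : EqOn f 0 (Ici 0) ∨ ∀ x, 0 < x → 0 < f x := by
  refine or_iff_not_imp_right.2 fun hpos x (hx : 0 ≤ x) => ?_
  push Not at hpos
  obtain ⟨z, hz, hfz⟩ := hpos
  refine le_antisymm (show f x ≤ 0 from ?_) (hf0 x hx)
  rcases le_total x z with hxz | hzx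
  · -- `z` is the midpoint of `x` and its reflection `2 * z - x`
    have hy : 2 * z - x ∈ Ici 0 := mem_Ici.2 (by linarith)
    have h := hf.2 (mem_Ici.2 hx) hy one_half_pos.le one_half_pos.le (add_halves 1)
    simp only [smul_eq_mul] at h
    rw [show 1 / 2 * x + 1 / 2 * (2 * z - x) = z by ring] at h
    have := hf0 _ hy
    linarith
  · have hx' : 0 < x := hz.trans_le hzx
    have h := mul_le_map_mul_of_concaveOn hf (hf0 0 self_mem_Ici) (div_nonneg hz.le hx)
      ((div_le_one hx').2 hzx) hx
    rw [div_mul_cancel₀ _ hx'.ne'] at h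
    exact nonpos_of_mul_nonpos_right (h.trans hfz) (div_pos hz hx')

section Kantorovich

variable {w s t α : ℝ}

theorem rpow_mul_rpow_le_mul_add_mul {a b u v : ℝ} (hα0 : 0 < α) (hα1 : α < 1) (ha : 0 ≤ a)
    (hb : 0 ≤ b) (hu : 0 ≤ u) (hv : 0 ≤ v) :
    (a / α) ^ α * (b / (1 - α)) ^ (1 - α) * (u ^ α * v ^ (1 - α)) ≤ a * u + b * v := by
  have hβ : 0 < 1 - α := sub_pos.2 hα1
  have ha' : 0 ≤ a / α := by positivity
  have hb' : 0 ≤ b / (1 - α) := by positivity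
  calc (a / α) ^ α * (b / (1 - α)) ^ (1 - α) * (u ^ α * v ^ (1 - α))
      = (a / α * u) ^ α * (b / (1 - α) * v) ^ (1 - α) := by
        rw [Real.mul_rpow ha' hu, Real.mul_rpow hb' hv]; ring
    _ ≤ α * (a / α * u) + (1 - α) * (b / (1 - α) * v) :=
        Real.geom_mean_le_arith_mean2_weighted hα0.le hβ.le (mul_nonneg ha' hu) (mul_nonneg hb' hv)
          (add_sub_cancel α 1)
    _ = a * u + b * v := by field_simp

theorem genKantorovich_eq_of_one_lt (hw : 1 < w) (hα0 : 0 < α) (hα1 : α < 1) :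
    genKantorovich w α = ((w ^ α - 1) / (w - 1) / α) ^ α *
      ((w - w ^ α) / (w - 1) / (1 - α)) ^ (1 - α) := by
  have hβ : 0 < 1 - α := sub_pos.2 hα1
  have hw' : 0 < w - 1 := sub_pos.2 hw
  have h1 : 0 < w ^ α - 1 := sub_pos.2 (Real.one_lt_rpow hw hα0)
  have h2 : 0 < w - w ^ α := sub_pos.2 (Real.rpow_lt_self_of_one_lt hw hα1)
  set M := (w ^ α - 1) / (w - 1) / α with hM
  set N := (w - w ^ α) / (w - 1) / (1 - α) with hN
  have hMpos : 0 < M := by positivity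
  have hNpos : 0 < N := by positivity
  have hfactor : (w ^ α - w) / ((α - 1) * (w - 1)) = N := by
    rw [hN, div_div, ← neg_div_neg_eq]; ring_nf
  have hbase : (α - 1) / α * ((w ^ α - 1) / (w ^ α - w)) = M / N := by
    rw [hM, hN, ← neg_sub w, ← neg_sub 1 α]; field_simp
  rw [genKantorovich, if_neg hw.ne', hfactor, hbase, Real.div_rpow hMpos.le hNpos.le,
    Real.rpow_sub hNpos, Real.rpow_one]
  ring

theorem exists_affine_le_rpow_of_one_le (hw : 1 ≤ w) (hα0 : 0 < α) (hα1 : α < 1) :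
    ∃ a b : ℝ, 0 ≤ a ∧ 0 ≤ b ∧ (∀ x ∈ Icc 1 w, a * x + b ≤ x ^ α) ∧
      genKantorovich w α = (a / α) ^ α * (b / (1 - α)) ^ (1 - α) := by
  have hβ : 0 < 1 - α := sub_pos.2 hα1
  rcases hw.eq_or_lt with rfl | hw
  · refine ⟨α, 1 - α, hα0.le, hβ.le, fun x hx => ?_, ?_⟩
    · simp [le_antisymm hx.2 hx.1]
    · simp [genKantorovich, div_self hα0.ne', div_self hβ.ne']
  have hw' : 0 < w - 1 := sub_pos.2 hw
  have h1 : 0 < w ^ α - 1 := sub_pos.2 (Real.one_lt_rpow hw hα0)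
  have h2 : 0 < w - w ^ α := sub_pos.2 (Real.rpow_lt_self_of_one_lt hw hα1)
  refine ⟨(w ^ α - 1) / (w - 1), (w - w ^ α) / (w - 1), by positivity, by positivity,
    fun x hx => ?_, genKantorovich_eq_of_one_lt hw hα0 hα1⟩
  -- the left-hand side is the chord of the concave function `x ↦ x ^ α` over `[1, w]`
  have hchord := (Real.concaveOn_rpow hα0.le hα1.le).2 (mem_Ici.2 zero_le_one)
    (mem_Ici.2 (zero_le_one.trans hw.le)) (div_nonneg (sub_nonneg.2 hx.2) hw'.le)
    (div_nonneg (sub_nonneg.2 hx.1) hw'.le) (by field_simp; ring)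
  simp only [smul_eq_mul, Real.one_rpow] at hchord
  have hcomb : (w - x) / (w - 1) * 1 + (x - 1) / (w - 1) * w = x := by field_simp; ring
  rw [hcomb] at hchord
  refine le_trans (le_of_eq ?_) hchord
  field_simp
  ring

theorem genKantorovich_nonneg (hw : 1 ≤ w) (hα0 : 0 < α) (hα1 : α < 1) :
    0 ≤ genKantorovich w α := by
  obtain ⟨a, b, ha, hb, -, hK⟩ := exists_affine_le_rpow_of_one_le hw hα0 hα1
  have : 0 < 1 - α := sub_pos.2 hα1
  rw [hK]
  positivity

theorem genKantorovich_le_one (hw : 1 ≤ w) (hα0 : 0 < α) (hα1 : α < 1) :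
    genKantorovich w α ≤ 1 := by
  obtain ⟨a, b, ha, hb, hab, hK⟩ := exists_affine_le_rpow_of_one_le hw hα0 hα1
  have h := (rpow_mul_rpow_le_mul_add_mul hα0 hα1 ha hb zero_le_one zero_le_one).trans
    ((mul_one b).symm ▸ hab 1 ⟨le_rfl, hw⟩)
  simpa only [← hK, Real.one_rpow, mul_one] using h

theorem exists_affine_le_rpow_and_genKantorovich_mul_le (hs : 0 < s) (hst : s ≤ t) (hα0 : 0 < α)
    (hα1 : α < 1) :
    ∃ a b : ℝ, (∀ x ∈ Icc s t, a * x + b ≤ x ^ α) ∧ ∀ u v : ℝ, 0 ≤ u → 0 ≤ v →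
      genKantorovich (t / s) α * (u ^ α * v ^ (1 - α)) ≤ a * u + b * v := by
  obtain ⟨a, b, ha, hb, hab, hK⟩ :=
    exists_affine_le_rpow_of_one_le ((one_le_div hs).2 hst) hα0 hα1
  have hsα : 0 < s ^ α := Real.rpow_pos_of_pos hs α
  refine ⟨s ^ α * (a / s), s ^ α * b, fun x hx => ?_, fun u v hu hv => ?_⟩
  · have h := hab (x / s) ⟨(one_le_div hs).2 hx.1, by have := hx.2; gcongr⟩
    rw [Real.div_rpow (hs.le.trans hx.1) hs.le, le_div_iff₀ hsα] at h
    exact le_trans (le_of_eq (by ring)) h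
  · have h := rpow_mul_rpow_le_mul_add_mul hα0 hα1 ha hb (div_nonneg hu hs.le) hv
    rw [← hK, Real.div_rpow hu hs.le] at h
    calc genKantorovich (t / s) α * (u ^ α * v ^ (1 - α))
        = s ^ α * (genKantorovich (t / s) α * (u ^ α / s ^ α * v ^ (1 - α))) := by field_simp
      _ ≤ s ^ α * (a * (u / s) + b * v) := by gcongr
      _ = s ^ α * (a / s) * u + s ^ α * b * v := by ring

end Kantorovich

section QuadraticForm

variable {𝕜 E : Type*} [RCLike 𝕜] [NormedAddCommGroup E] [InnerProductSpace 𝕜 E]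

theorem reApplyInnerSelf_add (S T : E →L[𝕜] E) (x : E) :
    (S + T).reApplyInnerSelf x = S.reApplyInnerSelf x + T.reApplyInnerSelf x := by
  simp [ContinuousLinearMap.reApplyInnerSelf_apply, inner_add_left]

theorem reApplyInnerSelf_one (x : E) : (1 : E →L[𝕜] E).reApplyInnerSelf x = ‖x‖ ^ 2 :=
  inner_self_eq_norm_sq x

theorem reApplyInnerSelf_nonneg {T : E →L[𝕜] E} (hT : 0 ≤ T) (x : E) : 0 ≤ T.reApplyInnerSelf x :=
  ((ContinuousLinearMap.nonneg_iff_isPositive T).1 hT).2 x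

theorem reApplyInnerSelf_mono {S T : E →L[𝕜] E} (h : S ≤ T) (x : E) :
    S.reApplyInnerSelf x ≤ T.reApplyInnerSelf x := by
  have : 0 ≤ (T - S).reApplyInnerSelf x := ((ContinuousLinearMap.le_def S T).1 h).2 x
  rw [← add_sub_cancel S T, reApplyInnerSelf_add]
  exact le_add_of_nonneg_right this

section Complete

variable [CompleteSpace E]

theorem reApplyInnerSelf_star_conj (S T : E →L[𝕜] E) (x : E) :
    (star S * T * S).reApplyInnerSelf x = T.reApplyInnerSelf (S x) := by
  simp only [ContinuousLinearMap.reApplyInnerSelf_apply, mul_apply_eq_comp,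
    ContinuousLinearMap.star_eq_adjoint, ContinuousLinearMap.adjoint_inner_left]

theorem reApplyInnerSelf_conj {S : E →L[𝕜] E} (hS : IsSelfAdjoint S) (T : E →L[𝕜] E) (x : E) :
    (S * T * S).reApplyInnerSelf x = T.reApplyInnerSelf (S x) := by
  simpa only [hS.star_eq] using reApplyInnerSelf_star_conj S T x

theorem reApplyInnerSelf_unitary_conj {U : E →L[𝕜] E} (hU : U ∈ unitary (E →L[𝕜] E))
    (T : E →L[𝕜] E) (x : E) :
    (U * T * star U).reApplyInnerSelf (U x) = T.reApplyInnerSelf x := by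
  have h := reApplyInnerSelf_star_conj (star U) T (U x)
  rwa [star_star, ← mul_apply_eq_comp, Unitary.star_mul_self_of_mem hU, one_apply_eq_self] at h

end Complete

end QuadraticForm

section FunctionalCalculus

variable {H : Type*} [NormedAddCommGroup H] [InnerProductSpace ℂ H]

theorem reApplyInnerSelf_real_smul (c : ℝ) (T : H →L[ℂ] H) (x : H) :
    (c • T).reApplyInnerSelf x = c * T.reApplyInnerSelf x := by
  rw [ContinuousLinearMap.reApplyInnerSelf_apply, smul_apply, ← Complex.coe_smul, inner_smul_left,
    Complex.conj_ofReal]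
  exact Complex.re_ofReal_mul c _

variable [CompleteSpace H] {T : H →L[ℂ] H} {f : ℝ → ℝ} {a b s t α : ℝ}

theorem spectrum_subset_Ici_of_nonneg (hT : 0 ≤ T) : spectrum ℝ T ⊆ Ici 0 :=
  fun _ hx => spectrum_nonneg_of_nonneg hT hx

theorem reApplyInnerSelf_cfc_affine (hT : IsSelfAdjoint T) (a b : ℝ) (x : H) :
    (cfc (fun y : ℝ => a * y + b) T).reApplyInnerSelf x =
      a * T.reApplyInnerSelf x + b * ‖x‖ ^ 2 := by
  rw [cfc_add_const b (fun y : ℝ => a * y) T, cfc_const_mul_id a T,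
    Algebra.algebraMap_eq_smul_one, reApplyInnerSelf_add, reApplyInnerSelf_real_smul,
    reApplyInnerSelf_real_smul, reApplyInnerSelf_one]

theorem reApplyInnerSelf_cfc_le (hT : IsSelfAdjoint T) (hf : ContinuousOn f (spectrum ℝ T))
    (h : ∀ y ∈ spectrum ℝ T, f y ≤ a * y + b) (x : H) :
    (cfc f T).reApplyInnerSelf x ≤ a * T.reApplyInnerSelf x + b * ‖x‖ ^ 2 := by
  rw [← reApplyInnerSelf_cfc_affine hT]
  exact reApplyInnerSelf_mono (cfc_mono h hf) x

theorem le_reApplyInnerSelf_cfc (hT : IsSelfAdjoint T) (hf : ContinuousOn f (spectrum ℝ T))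
    (h : ∀ y ∈ spectrum ℝ T, a * y + b ≤ f y) (x : H) :
    a * T.reApplyInnerSelf x + b * ‖x‖ ^ 2 ≤ (cfc f T).reApplyInnerSelf x := by
  rw [← reApplyInnerSelf_cfc_affine hT]
  exact reApplyInnerSelf_mono (cfc_mono h (by fun_prop) hf) x

theorem rayleighQuotient_cfc_le (hf : ConcaveOn ℝ (Ici 0) f) (hc : ContinuousOn f (Ici 0))
    (hT : 0 ≤ T) {x : H} (hx : x ≠ 0) :
    (cfc f T).rayleighQuotient x ≤ f (T.rayleighQuotient x) := by
  have hsp := spectrum_subset_Ici_of_nonneg hT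
  have hx2 : 0 < ‖x‖ ^ 2 := by positivity
  have hm : T.rayleighQuotient x ∈ Ici 0 := div_nonneg (reApplyInnerSelf_nonneg hT x) hx2.le
  -- a supporting line need not exist at the endpoint `0`, so pass through any value `r` above `f`
  refine le_of_forall_gt_imp_ge_of_dense fun r hr => ?_
  obtain ⟨a, b, hab, hr⟩ := ConvexOn.exists_affine_le_of_lt_real hm (f := -f) (neg_lt_neg hr)
    isClosed_Ici hc.neg.lowerSemicontinuousOn hf.neg
  have hle : ∀ y ∈ spectrum ℝ T, f y ≤ -a * y + -b := fun y hy => by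
    have := hab y (hsp hy)
    simp only [Pi.neg_apply] at this
    linarith
  rw [div_le_iff₀ hx2]
  refine (reApplyInnerSelf_cfc_le (.of_nonneg hT) (hc.mono hsp) hle x).trans_eq ?_
  rw [← neg_eq_iff_eq_neg.2 hr]
  field_simp
  ring

theorem reApplyInnerSelf_rpow_le (hT : 0 ≤ T) (hα0 : 0 < α) (hα1 : α < 1) (x : H) :
    (T ^ α).reApplyInnerSelf x ≤ T.reApplyInnerSelf x ^ α * (‖x‖ ^ 2) ^ (1 - α) := by
  rcases eq_or_ne x 0 with rfl | hx
  · simp [ContinuousLinearMap.reApplyInnerSelf_apply, Real.zero_rpow hα0.ne']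
  have hx2 : 0 < ‖x‖ ^ 2 := by positivity
  have h := rayleighQuotient_cfc_le (Real.concaveOn_rpow hα0.le hα1.le)
    (Real.continuous_rpow_const hα0.le).continuousOn hT hx
  rw [← CFC.rpow_eq_cfc_real hT, div_le_iff₀ hx2,
    Real.div_rpow (reApplyInnerSelf_nonneg hT x) hx2.le] at h
  refine h.trans_eq ?_
  rw [Real.rpow_sub hx2, Real.rpow_one]
  ring

theorem genKantorovich_mul_le_reApplyInnerSelf_rpow (hs : 0 < s) (hst : s ≤ t) (hα0 : 0 < α)
    (hα1 : α < 1) (hsT : s • 1 ≤ T) (hTt : T ≤ t • 1) (x : H) :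
    genKantorovich (t / s) α * (T.reApplyInnerSelf x ^ α * (‖x‖ ^ 2) ^ (1 - α)) ≤
      (T ^ α).reApplyInnerSelf x := by
  obtain ⟨a, b, hab, hK⟩ := exists_affine_le_rpow_and_genKantorovich_mul_le hs hst hα0 hα1
  have hT : 0 ≤ T := (smul_nonneg hs.le zero_le_one).trans hsT
  have hsa : IsSelfAdjoint T := .of_nonneg hT
  rw [← Algebra.algebraMap_eq_smul_one] at hsT hTt
  refine (hK _ _ (reApplyInnerSelf_nonneg hT x) (by positivity)).trans ?_
  rw [CFC.rpow_eq_cfc_real hT]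
  exact le_reApplyInnerSelf_cfc hsa (Real.continuous_rpow_const hα0.le).continuousOn
    (fun y hy => hab y ⟨(algebraMap_le_iff_le_spectrum hsa).1 hsT y hy,
      (le_algebraMap_iff_spectrum_le hsa).1 hTt y hy⟩) x

end FunctionalCalculus

section GeometricMean

variable {H : Type*} [NormedAddCommGroup H] [InnerProductSpace ℂ H] [CompleteSpace H]
  {A B : H →L[ℂ] H} {s t α : ℝ}

theorem rpow_half_mul_rpow_half (hA : IsStrictlyPositive A) :
    A ^ (1 / 2 : ℝ) * A ^ (1 / 2 : ℝ) = A := by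
  rw [← CFC.rpow_add hA.isUnit, add_halves, CFC.rpow_one A hA.nonneg]

theorem norm_sq_rpow_half_apply (hA : IsStrictlyPositive A) (x : H) :
    ‖(A ^ (1 / 2 : ℝ)) x‖ ^ 2 = A.reApplyInnerSelf x := by
  rw [← reApplyInnerSelf_one (𝕜 := ℂ), ← reApplyInnerSelf_conj (.of_nonneg CFC.rpow_nonneg),
    mul_one, rpow_half_mul_rpow_half hA]

theorem reApplyInnerSelf_conj_rpow_neg_half (hA : IsStrictlyPositive A) (B : H →L[ℂ] H) (x : H) :
    (A ^ (-(1 / 2) : ℝ) * B * A ^ (-(1 / 2) : ℝ)).reApplyInnerSelf ((A ^ (1 / 2 : ℝ)) x) =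
      B.reApplyInnerSelf x := by
  rw [reApplyInnerSelf_conj (.of_nonneg CFC.rpow_nonneg), ← mul_apply_eq_comp,
    CFC.rpow_neg_mul_rpow _ hA, one_apply_eq_self]

theorem reApplyInnerSelf_opGeomMean (α : ℝ) (A B : H →L[ℂ] H) (x : H) :
    (opGeomMean α A B).reApplyInnerSelf x =
      ((A ^ (-(1 / 2) : ℝ) * B * A ^ (-(1 / 2) : ℝ)) ^ α).reApplyInnerSelf
        ((A ^ (1 / 2 : ℝ)) x) :=
  reApplyInnerSelf_conj (.of_nonneg CFC.rpow_nonneg) _ x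

theorem opGeomMean_zero_left (α : ℝ) (B : H →L[ℂ] H) : opGeomMean α 0 B = 0 := by
  have h : (0 : H →L[ℂ] H) ^ (1 / 2 : ℝ) = 0 := CFC.zero_rpow one_half_pos.ne'
  rw [opGeomMean, h, zero_mul, zero_mul]

theorem opGeomMean_nonneg (α : ℝ) (A B : H →L[ℂ] H) : 0 ≤ opGeomMean α A B :=
  (IsSelfAdjoint.of_nonneg CFC.rpow_nonneg).conjugate_nonneg CFC.rpow_nonneg

theorem reApplyInnerSelf_opGeomMean_le (hA : IsStrictlyPositive A) (hB : 0 ≤ B) (hα0 : 0 < α)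
    (hα1 : α < 1) (x : H) :
    (opGeomMean α A B).reApplyInnerSelf x ≤
      B.reApplyInnerSelf x ^ α * A.reApplyInnerSelf x ^ (1 - α) := by
  have hM : 0 ≤ A ^ (-(1 / 2) : ℝ) * B * A ^ (-(1 / 2) : ℝ) :=
    (IsSelfAdjoint.of_nonneg CFC.rpow_nonneg).conjugate_nonneg hB
  have h := reApplyInnerSelf_rpow_le hM hα0 hα1 ((A ^ (1 / 2 : ℝ)) x)
  rwa [← reApplyInnerSelf_opGeomMean, reApplyInnerSelf_conj_rpow_neg_half hA,
    norm_sq_rpow_half_apply hA] at h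

theorem genKantorovich_mul_le_reApplyInnerSelf_opGeomMean (hA : IsStrictlyPositive A)
    (hs : 0 < s) (hst : s ≤ t) (hα0 : 0 < α) (hα1 : α < 1) (hsAB : s • A ≤ B) (htAB : B ≤ t • A)
    (x : H) :
    genKantorovich (t / s) α * (B.reApplyInnerSelf x ^ α * A.reApplyInnerSelf x ^ (1 - α)) ≤
      (opGeomMean α A B).reApplyInnerSelf x := by
  have hsa : IsSelfAdjoint (A ^ (-(1 / 2) : ℝ)) := .of_nonneg CFC.rpow_nonneg
  have hsM := hsa.conjugate_le_conjugate hsAB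
  have hMt := hsa.conjugate_le_conjugate htAB
  rw [mul_smul_comm, smul_mul_assoc, CFC.conjugate_rpow_neg_one_half A hA] at hsM hMt
  have h := genKantorovich_mul_le_reApplyInnerSelf_rpow hs hst hα0 hα1 hsM hMt
    ((A ^ (1 / 2 : ℝ)) x)
  rwa [← reApplyInnerSelf_opGeomMean, reApplyInnerSelf_conj_rpow_neg_half hA,
    norm_sq_rpow_half_apply hA] at h

end GeometricMean

section Eigenvalues

theorem exists_norm_eq_one_forall_inner_eq_zero {𝕜 E κ : Type*} [RCLike 𝕜] [NormedAddCommGroup E]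
    [InnerProductSpace 𝕜 E] [FiniteDimensional 𝕜 E] [Fintype κ]
    (hκ : Fintype.card κ < Module.finrank 𝕜 E) (v : κ → E) :
    ∃ x : E, ‖x‖ = 1 ∧ ∀ i, inner 𝕜 (v i) x = 0 := by
  let F : E →ₗ[𝕜] κ → 𝕜 := LinearMap.pi fun i => innerₛₗ 𝕜 (v i)
  obtain ⟨y, hy, hy0⟩ := Submodule.exists_mem_ne_zero_of_ne_bot
    (LinearMap.ker_ne_bot_of_finrank_lt (f := F) (by rwa [Module.finrank_fintype_fun_eq_card]))
  refine ⟨(‖y‖⁻¹ : 𝕜) • y, norm_smul_inv_norm hy0, fun i => ?_⟩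
  have hyi : inner 𝕜 (v i) y = 0 := congr_fun (LinearMap.mem_ker.1 hy) i
  rw [inner_smul_right, hyi, mul_zero]

section Eigenbasis

variable {𝕜 E ι : Type*} [RCLike 𝕜] [NormedAddCommGroup E] [InnerProductSpace 𝕜 E] [Fintype ι]
  {T : E →L[𝕜] E} {c : ι → ℝ} {r : ℝ} {x : E} (b : OrthonormalBasis ι 𝕜 E)
  (hT : ∀ i, T (b i) = (c i : 𝕜) • b i)
include hT

theorem reApplyInnerSelf_eq_sum (x : E) :
    T.reApplyInnerSelf x = ∑ i, c i * ‖inner 𝕜 (b i) x‖ ^ 2 := by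
  have hTx : T x = ∑ i, inner 𝕜 (b i) x • (c i : 𝕜) • b i := by
    conv_lhs => rw [← b.sum_repr' x]
    simp only [map_sum, map_smul, hT]
  rw [ContinuousLinearMap.reApplyInnerSelf_apply, hTx, sum_inner, map_sum]
  refine Finset.sum_congr rfl fun i _ => ?_
  rw [inner_smul_left, inner_smul_left, RCLike.conj_ofReal, mul_left_comm, RCLike.conj_mul,
    ← RCLike.ofReal_pow, ← RCLike.ofReal_mul, RCLike.ofReal_re]

theorem reApplyInnerSelf_le_of_eigenbasis (hr : ∀ i, inner 𝕜 (b i) x ≠ 0 → c i ≤ r) :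
    T.reApplyInnerSelf x ≤ r * ‖x‖ ^ 2 := by
  rw [reApplyInnerSelf_eq_sum b hT, ← b.sum_sq_norm_inner_right, Finset.mul_sum]
  refine Finset.sum_le_sum fun i _ => ?_
  rcases eq_or_ne (inner 𝕜 (b i) x) 0 with h | h
  · simp [h]
  · exact mul_le_mul_of_nonneg_right (hr i h) (sq_nonneg _)

theorem le_reApplyInnerSelf_of_eigenbasis (hr : ∀ i, inner 𝕜 (b i) x ≠ 0 → r ≤ c i) :
    r * ‖x‖ ^ 2 ≤ T.reApplyInnerSelf x := by
  rw [reApplyInnerSelf_eq_sum b hT, ← b.sum_sq_norm_inner_right, Finset.mul_sum]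
  refine Finset.sum_le_sum fun i _ => ?_
  rcases eq_or_ne (inner 𝕜 (b i) x) 0 with h | h
  · simp [h]
  · exact mul_le_mul_of_nonneg_right (hr i h) (sq_nonneg _)

end Eigenbasis

variable {H : Type*} [NormedAddCommGroup H] [InnerProductSpace ℂ H] {f : ℝ → ℝ}

theorem le_of_common_eigenbasis {ι : Type*} [Fintype ι] [CompleteSpace H]
    {S T : H →L[ℂ] H} {c d : ι → ℝ} (hS : IsSelfAdjoint S) (hT : IsSelfAdjoint T)
    (b : OrthonormalBasis ι ℂ H) (hSb : ∀ i, S (b i) = (c i : ℂ) • b i)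
    (hTb : ∀ i, T (b i) = (d i : ℂ) • b i) (hcd : ∀ i, c i ≤ d i) : S ≤ T := by
  refine (ContinuousLinearMap.le_def S T).2
    (ContinuousLinearMap.isPositive_def'.2 ⟨hT.sub hS, fun x => ?_⟩)
  rw [reApplyInnerSelf_eq_sum (c := d - c) b fun i => by simp [hSb, hTb, sub_smul]]
  exact Finset.sum_nonneg fun i _ => mul_nonneg (sub_nonneg.2 (hcd i)) (sq_nonneg _)

variable [FiniteDimensional ℂ H]

theorem finite_real_spectrum (T : H →L[ℂ] H) : (spectrum ℝ T).Finite := by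
  rw [← spectrum.preimage_algebraMap ℂ, ContinuousLinearMap.spectrum_eq]
  exact (Module.End.finite_spectrum _).preimage (FaithfulSMul.algebraMap_injective ℝ ℂ).injOn

theorem exists_norm_eq_one_inner_eq_zero {n : ℕ} (b c : OrthonormalBasis (Fin n) ℂ H)
    (j : Fin n) :
    ∃ x : H, ‖x‖ = 1 ∧ (∀ i, inner ℂ (b i) x ≠ 0 → j ≤ i) ∧ ∀ i, inner ℂ (c i) x ≠ 0 → i ≤ j := by
  have hcard : Fintype.card {i : Fin n // i ≠ j} < Module.finrank ℂ H := by
    rw [Module.finrank_eq_card_basis b.toBasis]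
    exact Fintype.card_subtype_lt (x := j) (not_not.2 rfl)
  obtain ⟨x, hx, hv⟩ := exists_norm_eq_one_forall_inner_eq_zero (𝕜 := ℂ) hcard
    fun i => if (i : Fin n) < j then b i else c i
  refine ⟨x, hx, fun i hi => not_lt.1 fun hij => hi ?_, fun i hi => not_lt.1 fun hji => hi ?_⟩
  · simpa only [if_pos hij] using hv ⟨i, hij.ne⟩
  · simpa only [if_neg hji.not_gt] using hv ⟨i, hji.ne'⟩

theorem eigenvalues_le_map_eigenvalues (hf : MonotoneOn f (Ici 0)) {X Z : H →L[ℂ] H}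
    (hX : 0 ≤ X) (hXs : X.IsSymmetric) (hZs : Z.IsSymmetric)
    (h : ∀ x : H, ‖x‖ = 1 → Z.reApplyInnerSelf x ≤ f (X.reApplyInnerSelf x))
    (j : Fin (Module.finrank ℂ H)) : hZs.eigenvalues rfl j ≤ f (hXs.eigenvalues rfl j) := by
  obtain ⟨x, hx, hxb, hxc⟩ := exists_norm_eq_one_inner_eq_zero (hXs.eigenvectorBasis rfl)
    (hZs.eigenvectorBasis rfl) j
  have hXx : X.reApplyInnerSelf x ≤ hXs.eigenvalues rfl j := by
    simpa only [hx, one_pow, mul_one] using reApplyInnerSelf_le_of_eigenbasis _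
      (hXs.apply_eigenvectorBasis rfl) fun i hi => hXs.eigenvalues_antitone rfl (hxb i hi)
  have hZx : hZs.eigenvalues rfl j ≤ Z.reApplyInnerSelf x := by
    simpa only [hx, one_pow, mul_one] using le_reApplyInnerSelf_of_eigenbasis _
      (hZs.apply_eigenvectorBasis rfl) fun i hi => hZs.eigenvalues_antitone rfl (hxc i hi)
  have hX0 := reApplyInnerSelf_nonneg hX x
  exact hZx.trans ((h x hx).trans (hf hX0 (hX0.trans hXx) hXx))

variable [CompleteSpace H]

theorem cfc_apply_of_apply_eq_smul {T : H →L[ℂ] H} (hT : IsSelfAdjoint T) (f : ℝ → ℝ) {c : ℝ}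
    {v : H} (hv : T v = (c : ℂ) • v) : cfc f T v = (f c : ℂ) • v := by
  have hcont (g : ℝ → ℝ) : ContinuousOn g (spectrum ℝ T) := (finite_real_spectrum T).continuousOn g
  have hslope : f = fun y => f c + slope f c y * (y - c) := by
    ext y
    rcases eq_or_ne y c with rfl | hy
    · simp
    · rw [slope_def_field, div_mul_cancel₀ _ (sub_ne_zero.2 hy), add_sub_cancel]
  have hcfc : cfc f T = algebraMap ℝ _ (f c) + cfc (slope f c) T * (T - algebraMap ℝ _ c) := by
    conv_lhs => rw [hslope]
    rw [cfc_const_add (f c) _ T (hcont _), cfc_mul _ _ T (hcont _), cfc_sub _ _ T,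
      cfc_id' ℝ T, cfc_const c T]
  have hker : (T - algebraMap ℝ _ c) v = 0 := by
    simp [hv, Algebra.algebraMap_eq_smul_one]
  rw [hcfc, add_apply, mul_apply_eq_comp, hker, map_zero, add_zero,
    Algebra.algebraMap_eq_smul_one, smul_apply, one_apply_eq_self, Complex.coe_smul]

theorem exists_unitary_conj_le_cfc (hf : MonotoneOn f (Ici 0)) {X Z : H →L[ℂ] H} (hX : 0 ≤ X)
    (hZ : IsSelfAdjoint Z)
    (h : ∀ x : H, ‖x‖ = 1 → Z.reApplyInnerSelf x ≤ f (X.reApplyInnerSelf x)) :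
    ∃ U ∈ unitary (H →L[ℂ] H), U * Z * star U ≤ cfc f X := by
  have hXsa : IsSelfAdjoint X := .of_nonneg hX
  have hXs := hXsa.isSymmetric
  have hZs := hZ.isSymmetric
  let b := hXs.eigenvectorBasis rfl
  let c := hZs.eigenvectorBasis rfl
  let U := Unitary.linearIsometryEquiv.symm (c.equiv b (Equiv.refl _))
  have hUc (i) : (U : H →L[ℂ] H) (c i) = b i := c.equiv_apply_basis b (Equiv.refl _) i
  have hUb (i) : star (U : H →L[ℂ] H) (b i) = c i := by
    rw [← hUc i, ← mul_apply_eq_comp, Unitary.coe_star_mul_self, one_apply_eq_self]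
  refine ⟨U, U.2, le_of_common_eigenbasis (hZ.conjugate _) (cfc_predicate f X) b (fun i => ?_)
    (fun i => cfc_apply_of_apply_eq_smul hXsa f (hXs.apply_eigenvectorBasis rfl i))
    (eigenvalues_le_map_eigenvalues hf hX hXs hZs h)⟩
  have hZc : Z (c i) = (hZs.eigenvalues rfl i : ℂ) • c i :=
    hZs.apply_eigenvectorBasis rfl i
  rw [mul_apply_eq_comp, mul_apply_eq_comp, hUb, hZc, map_smul, hUc]

end Eigenvalues

section DoublyConcave

variable {H : Type*} [NormedAddCommGroup H] [InnerProductSpace ℂ H] [CompleteSpace H]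
  {f : ℝ → ℝ} {C D T : H →L[ℂ] H} {k s t α : ℝ}

theorem isStrictlyPositive_cfc (hf : ContinuousOn f (Ici 0)) (hpos : ∀ x, 0 < x → 0 < f x)
    (hT : IsStrictlyPositive T) : IsStrictlyPositive (cfc f T) := by
  refine CStarAlgebra.isStrictlyPositive_iff_isSelfAdjoint_and_spectrum_pos.2
    ⟨cfc_predicate f T, fun x hx => ?_⟩
  rw [cfc_map_spectrum f T hT.isSelfAdjoint (hf.mono (spectrum_subset_Ici_of_nonneg hT.nonneg))]
    at hx
  obtain ⟨y, hy, rfl⟩ := hx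
  exact hpos y ((StarOrderedRing.isStrictlyPositive_iff_spectrum_pos T).1 hT y hy)

theorem cfc_eq_zero_of_eqOn (hf : EqOn f 0 (Ici 0)) (hT : 0 ≤ T) : cfc f T = 0 := by
  rw [cfc_congr (hf.mono (spectrum_subset_Ici_of_nonneg hT)), cfc_zero]

theorem smul_cfc_le_cfc_smul (hf : ConcaveOn ℝ (Ici 0) f) (hc : ContinuousOn f (Ici 0))
    (hf0 : 0 ≤ f 0) (hT : 0 ≤ T) (hk0 : 0 ≤ k) (hk1 : k ≤ 1) : k • cfc f T ≤ cfc f (k • T) := by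
  have hsp := spectrum_subset_Ici_of_nonneg hT
  have hmaps : MapsTo (k * ·) (spectrum ℝ T) (Ici 0) := fun x hx => mul_nonneg hk0 (hsp hx)
  rw [← cfc_comp_smul k f T (hc.mono hmaps.image_subset) (.of_nonneg hT),
    ← cfc_smul k f T (hc.mono hsp)]
  exact cfc_mono (fun x hx => mul_le_map_mul_of_concaveOn hf hf0 hk0 hk1 (hsp hx))
    ((hc.mono hsp).const_smul k) (hc.comp (by fun_prop) hmaps)

theorem cfc_smul_le_smul_cfc (hf : ConcaveOn ℝ (Ici 0) f) (hc : ContinuousOn f (Ici 0))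
    (hf0 : 0 ≤ f 0) (hT : 0 ≤ T) (hk : 1 ≤ k) : cfc f (k • T) ≤ k • cfc f T := by
  have hk0 : 0 < k := one_pos.trans_le hk
  have h := smul_cfc_le_cfc_smul hf hc hf0 (smul_nonneg hk0.le hT) (inv_nonneg.2 hk0.le)
    (inv_le_one_of_one_le₀ hk)
  rw [inv_smul_smul₀ hk0.ne'] at h
  simpa only [smul_inv_smul₀ hk0.ne'] using smul_le_smul_of_nonneg_left h hk0.le

theorem reApplyInnerSelf_cfc_le_of_norm_eq_one (hf : ConcaveOn ℝ (Ici 0) f)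
    (hc : ContinuousOn f (Ici 0)) (hT : 0 ≤ T) {x : H} (hx : ‖x‖ = 1) :
    (cfc f T).reApplyInnerSelf x ≤ f (T.reApplyInnerSelf x) := by
  have h := rayleighQuotient_cfc_le hf hc hT (norm_ne_zero_iff.1 (hx.trans_ne one_ne_zero))
  rwa [ContinuousLinearMap.rayleighQuotient, ContinuousLinearMap.rayleighQuotient, hx, one_pow,
    div_one, div_one] at h

theorem reApplyInnerSelf_opGeomMean_cfc_le (hf : DoublyConcaveOn (Ici 0) f) (hC : 0 ≤ C)
    (hD : 0 ≤ D) (hfC : IsStrictlyPositive (cfc f C)) (hα0 : 0 < α) (hα1 : α < 1) {x : H}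
    (hx : ‖x‖ = 1) :
    (opGeomMean α (cfc f C) (cfc f D)).reApplyInnerSelf x ≤
      f (D.reApplyInnerSelf x ^ α * C.reApplyInnerSelf x ^ (1 - α)) := by
  have hfD : 0 ≤ cfc f D :=
    cfc_nonneg fun y hy => hf.nonneg y (spectrum_subset_Ici_of_nonneg hD hy)
  have hfCx := reApplyInnerSelf_nonneg hfC.nonneg x
  have hfDx := reApplyInnerSelf_nonneg hfD x
  calc (opGeomMean α (cfc f C) (cfc f D)).reApplyInnerSelf x
      ≤ (cfc f D).reApplyInnerSelf x ^ α * (cfc f C).reApplyInnerSelf x ^ (1 - α) :=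
        reApplyInnerSelf_opGeomMean_le hfC hfD hα0 hα1 x
    _ ≤ f (D.reApplyInnerSelf x) ^ α * f (C.reApplyInnerSelf x) ^ (1 - α) := by
        have hJC := reApplyInnerSelf_cfc_le_of_norm_eq_one hf.concave hf.continuousOn hC hx
        have hJD := reApplyInnerSelf_cfc_le_of_norm_eq_one hf.concave hf.continuousOn hD hx
        gcongr
        exact Real.rpow_nonneg (hfDx.trans hJD) α
    _ ≤ f (D.reApplyInnerSelf x ^ α * C.reApplyInnerSelf x ^ (1 - α)) :=
        hf.geomConcave _ (reApplyInnerSelf_nonneg hD x) _ (reApplyInnerSelf_nonneg hC x) α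
          ⟨hα0.le, hα1.le⟩

theorem genKantorovich_mul_reApplyInnerSelf_opGeomMean_cfc_le (hf : DoublyConcaveOn (Ici 0) f)
    (hmono : MonotoneOn f (Ici 0)) (hC : IsStrictlyPositive C)
    (hfC : IsStrictlyPositive (cfc f C)) (hs : 0 < s) (hst : s ≤ t) (hα0 : 0 < α) (hα1 : α < 1)
    (hsCD : s • C ≤ D) (htCD : D ≤ t • C) {x : H} (hx : ‖x‖ = 1) :
    genKantorovich (t / s) α * (opGeomMean α (cfc f C) (cfc f D)).reApplyInnerSelf x ≤
      f ((opGeomMean α C D).reApplyInnerSelf x) := by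
  have hD : 0 ≤ D := (smul_nonneg hs.le hC.nonneg).trans hsCD
  have hw : 1 ≤ t / s := (one_le_div hs).2 hst
  have hK0 := genKantorovich_nonneg hw hα0 hα1
  have hG : 0 ≤ D.reApplyInnerSelf x ^ α * C.reApplyInnerSelf x ^ (1 - α) :=
    mul_nonneg (Real.rpow_nonneg (reApplyInnerSelf_nonneg hD x) _)
      (Real.rpow_nonneg (reApplyInnerSelf_nonneg hC.nonneg x) _)
  calc genKantorovich (t / s) α * (opGeomMean α (cfc f C) (cfc f D)).reApplyInnerSelf x
      ≤ genKantorovich (t / s) α *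
          f (D.reApplyInnerSelf x ^ α * C.reApplyInnerSelf x ^ (1 - α)) :=
        mul_le_mul_of_nonneg_left
          (reApplyInnerSelf_opGeomMean_cfc_le hf hC.nonneg hD hfC hα0 hα1 hx) hK0
    _ ≤ f (genKantorovich (t / s) α *
          (D.reApplyInnerSelf x ^ α * C.reApplyInnerSelf x ^ (1 - α))) :=
        mul_le_map_mul_of_concaveOn hf.concave (hf.nonneg 0 self_mem_Ici) hK0
          (genKantorovich_le_one hw hα0 hα1) hG
    _ ≤ f ((opGeomMean α C D).reApplyInnerSelf x) :=
        hmono (mul_nonneg hK0 hG) (reApplyInnerSelf_nonneg (opGeomMean_nonneg α C D) x)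
          (genKantorovich_mul_le_reApplyInnerSelf_opGeomMean hC hs hst hα0 hα1 hsCD htCD x)

theorem genKantorovich_mul_le_reApplyInnerSelf_opGeomMean_cfc (hf : ConcaveOn ℝ (Ici 0) f)
    (hc : ContinuousOn f (Ici 0)) (hf0 : ∀ x ∈ Ici 0, 0 ≤ f x) (hop : OperatorMonotone H f)
    (hC : IsStrictlyPositive C) (hs : 0 < s) (hs1 : s ≤ 1) (ht1 : 1 ≤ t) (hα0 : 0 < α)
    (hα1 : α < 1) (hsCD : s • C ≤ D) (htCD : D ≤ t • C) (x : H) :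
    genKantorovich (t / s) α *
        ((cfc f D).reApplyInnerSelf x ^ α * (cfc f C).reApplyInnerSelf x ^ (1 - α)) ≤
      (opGeomMean α (cfc f C) (cfc f D)).reApplyInnerSelf x := by
  have hsC : IsStrictlyPositive (s • C) := .smul hs hC
  have hD : IsStrictlyPositive D := hsC.of_le hsCD
  rcases eqOn_zero_or_forall_pos_of_concaveOn hf hf0 with hzero | hpos
  · rw [cfc_eq_zero_of_eqOn hzero hC.nonneg, cfc_eq_zero_of_eqOn hzero hD.nonneg,
      opGeomMean_zero_left]
    simp [ContinuousLinearMap.reApplyInnerSelf_apply, Real.zero_rpow hα0.ne']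
  have hf0' : 0 ≤ f 0 := hf0 0 self_mem_Ici
  have hsf : s • cfc f C ≤ cfc f D :=
    (smul_cfc_le_cfc_smul hf hc hf0' hC.nonneg hs.le hs1).trans (hop _ _ hD hsC hsCD)
  have hft : cfc f D ≤ t • cfc f C :=
    (hop _ _ (.smul (one_pos.trans_le ht1) hC) hD htCD).trans
      (cfc_smul_le_smul_cfc hf hc hf0' hC.nonneg ht1)
  exact genKantorovich_mul_le_reApplyInnerSelf_opGeomMean (isStrictlyPositive_cfc hc hpos hC) hs
    (hs1.trans ht1) hα0 hα1 hsf hft x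

theorem exists_unitary_genKantorovich_smul_conj_opGeomMean_cfc_le [FiniteDimensional ℂ H]
    (hf : DoublyConcaveOn (Ici 0) f) (hmono : MonotoneOn f (Ici 0)) (hC : IsStrictlyPositive C)
    (hs : 0 < s) (hst : s ≤ t) (hα0 : 0 < α) (hα1 : α < 1) (hsCD : s • C ≤ D)
    (htCD : D ≤ t • C) :
    ∃ U ∈ unitary (H →L[ℂ] H),
      genKantorovich (t / s) α • (U * opGeomMean α (cfc f C) (cfc f D) * star U) ≤
        cfc f (opGeomMean α C D) := by
  have hG := opGeomMean_nonneg α C D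
  rcases eqOn_zero_or_forall_pos_of_concaveOn hf.concave hf.nonneg with hzero | hpos
  · refine ⟨1, one_mem _, ?_⟩
    rw [cfc_eq_zero_of_eqOn hzero hC.nonneg, cfc_eq_zero_of_eqOn hzero hG, opGeomMean_zero_left,
      mul_zero, zero_mul, smul_zero]
  obtain ⟨U, hU, hle⟩ := exists_unitary_conj_le_cfc hmono hG
    (Z := genKantorovich (t / s) α • opGeomMean α (cfc f C) (cfc f D))
    ((IsSelfAdjoint.all _).smul (.of_nonneg (opGeomMean_nonneg α _ _)))
    fun x hx => (reApplyInnerSelf_real_smul _ _ x).trans_le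
      (genKantorovich_mul_reApplyInnerSelf_opGeomMean_cfc_le hf hmono hC
        (isStrictlyPositive_cfc hf.continuousOn hpos hC) hs hst hα0 hα1 hsCD htCD hx)
  rw [mul_smul_comm, smul_mul_assoc] at hle
  exact ⟨U, hU, hle⟩

end DoublyConcave

theorem mainTheorem5 {H : Type*} [NormedAddCommGroup H] [InnerProductSpace ℂ H] [CompleteSpace H]
    [FiniteDimensional ℂ H] (f : ℝ → ℝ) (hf : DoublyConcaveOn (Set.Ici 0) f)
    (hmono : MonotoneOn f (Set.Ici 0)) (p q : ℝ) (hp : 1 < p) (hq : 1 < q)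
    (hpq : 1 / p + 1 / q = 1) (s t : ℝ) (hs : 0 < s) (hst : s ≤ t)
    (A B : H →L[ℂ] H) (hA : 0 ≤ A) (hB : 0 ≤ B) (hpos : IsStrictlyPositive (s • A ^ p))
    (hsAB : s • A ^ p ≤ B ^ q) (htAB : B ^ q ≤ t • A ^ p) :
    ∃ U ∈ unitary (H →L[ℂ] H),
      genKantorovich (t / s) (1 / q) •
          (U * opGeomMean (1 / q) (cfc f (A ^ p)) (cfc f (B ^ q)) * star U) ≤
        cfc f (opGeomMean (1 / q) (A ^ p) (B ^ q)) ∧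
      (OperatorMonotone H f → s ≤ 1 → 1 ≤ t → ∀ x : H,
        genKantorovich (t / s) (1 / q) ^ 2 *
            ((inner ℂ (cfc f (A ^ p) x) x).re ^ (1 / p) *
              (inner ℂ (cfc f (B ^ q) x) x).re ^ (1 / q)) ≤
          (inner ℂ (cfc f (opGeomMean (1 / q) (A ^ p) (B ^ q)) (U x)) (U x)).re) := by
  have hq0 : 0 < 1 / q := by positivity
  have hq1 : 1 / q < 1 := (div_lt_one (one_pos.trans hq)).2 hq
  have hC : IsStrictlyPositive (A ^ p) := by
    simpa only [inv_smul_smul₀ hs.ne'] using IsStrictlyPositive.smul (inv_pos.2 hs) hpos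
  obtain ⟨U, hU, hle⟩ := exists_unitary_genKantorovich_smul_conj_opGeomMean_cfc_le hf hmono hC hs
    hst hq0 hq1 hsAB htAB
  refine ⟨U, hU, hle, fun hop hs1 ht1 x => ?_⟩
  set G := opGeomMean (1 / q) (cfc f (A ^ p)) (cfc f (B ^ q))
  have hK := genKantorovich_nonneg ((one_le_div hs).2 hst) hq0 hq1
  have hG := genKantorovich_mul_le_reApplyInnerSelf_opGeomMean_cfc hf.concave hf.continuousOn
    hf.nonneg hop hC hs hs1 ht1 hq0 hq1 hsAB htAB x
  rw [← eq_sub_of_add_eq hpq, mul_comm (_ ^ (1 / q))] at hG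
  refine le_trans ?_ (reApplyInnerSelf_mono hle (U x))
  rw [reApplyInnerSelf_real_smul, reApplyInnerSelf_unitary_conj hU, sq, mul_assoc]
  exact mul_le_mul_of_nonneg_left hG hK
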